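/- All graphs are finite and simple. A graph $H$ is a minor of a graph $G$ if $H$ can be obtained from $G$ (up to isomorphism) by deleting vertices, deleting edges and contracting edges; equivalently, there are pairwise disjoint sets $\mu(w)\subseteq V(G)$, $w\in V(H)$, each inducing a connected non-empty subgraph of $G$, such that $G$ has an edge between $\mu(u)$ and $\mu(w)$ for every edge $uw$ of $H$. A graph $G$ is $3$-connected if $|V(G)|>3$ and $G-S$ is connected for every set $S$ of fewer than three vertices. Let $D_{17}$ be the graph on the eight vertices $d^i_j$ ($1\le i\le 2$, $1\le j\le 4$) that consists of the two complete graphs $K_4$ on $\{d^1_1,d^1_2,d^1_3,d^1_4\}$ and $\{d^2_1,d^2_2,d^2_3,d^2_4\}$ together with the four edges $d^1_jd^2_j$. Let $E_{20}$ be the graph on the nine vertices $e^0,e^1_1,e^1_2,e^1_3,e^2,e^3_1,e^3_2,e^3_3,e^4$ with the $16$ edges consisting of the six edges of the $K_4$ on $\{e^0,e^1_1,e^1_2,e^1_3\}$, the edge $e^0e^2$, and the edges $e^1_ie^3_i$, $e^2e^3_i$, $e^3_ie^4$ for $i=1,2,3$. Let $G$ be a $3$-connected graph that has $D_{17}$ as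 a minor and satisfies $|V(G)|>|V(D_{17})|=8$. Then $G$ has $K_{3,4}$ or $E_{20}$ as a minor. -/

import Mathlib

/-- `H` is a minor of `G`: there are pairwise disjoint branch sets `μ w` in `G`, one for each vertex
`w` of `H`, each inducing a connected (in particular nonempty) subgraph of `G`, such that `G` has
an edge between the branch sets of any two adjacent vertices of `H`. Contracting the branch sets
and deleting the remaining vertices and edges produces `H`. -/
def SimpleGraph.IsMinor {W V : Type*} (H : SimpleGraph W) (G : SimpleGraph V) : Prop :=
  ∃ μ : W → Set V,
    (∀ w, (G.induce (μ w)).Connected) ∧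
    (∀ u w, u ≠ w → Disjoint (μ u) (μ w)) ∧
    ∀ u w, H.Adj u w → ∃ x ∈ μ u, ∃ y ∈ μ w, G.Adj x y

/-- A finite graph `G` is `k`-connected if it has more than `k` vertices and deleting fewer than
`k` vertices never disconnects it. -/
def SimpleGraph.IsKConnected {V : Type*} [Finite V] (k : ℕ) (G : SimpleGraph V) : Prop :=
  k < Nat.card V ∧ ∀ S : Set V, S.ncard < k → (G.induce Sᶜ).Connected

/-- The graph `D₁₇`: two disjoint copies of `K₄` joined by a perfect matching. The vertex `(i, j)`
is the `j`-th vertex of the `i`-th copy. -/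
def graphD17 : SimpleGraph (Fin 2 × Fin 4) where
  Adj a b := (a.1 = b.1 ∧ a.2 ≠ b.2) ∨ (a.1 ≠ b.1 ∧ a.2 = b.2)
  symm := ⟨by
    rintro a b (⟨h, h'⟩ | ⟨h, h'⟩)
    · exact Or.inl ⟨h.symm, h'.symm⟩
    · exact Or.inr ⟨h.symm, h'.symm⟩⟩
  loopless := ⟨by rintro a (⟨_, h⟩ | ⟨h, _⟩) <;> exact h rfl⟩

/-- The graph `E₂₀`, with 9 vertices and 16 edges. Vertices: `0` is `e⁰`; `1, 2, 3` are
`e¹₁, e¹₂, e¹₃`; `4` is `e²`; `5, 6, 7` are `e³₁, e³₂, e³₃`; `8` is `e⁴`. The vertices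
`e⁰, e¹₁, e¹₂, e¹₃` form a `K₄`, `e²` is adjacent to `e⁰` and all `e³ᵢ`, each `e³ᵢ` is adjacent to
`e¹ᵢ`, and `e⁴` is adjacent to all `e³ᵢ`. -/
def graphE20 : SimpleGraph (Fin 9) :=
  SimpleGraph.fromRel fun a b => (a, b) ∈
    ([(0, 1), (0, 2), (0, 3), (1, 2), (1, 3), (2, 3),
      (0, 4), (1, 5), (2, 6), (3, 7),
      (4, 5), (4, 6), (4, 7),
      (5, 8), (6, 8), (7, 8)] : List (Fin 9 × Fin 9))

/-! Enlarge the branch sets of a `D₁₇` model until they partition the vertices of G. The key claim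
is that some branch set divides into two connected parts, each adjacent to at least two other branch
sets. G then has as a minor a graph obtained from `D₁₇` by splitting a vertex, possibly with extra
edges at the two new vertices.

The claim is where 3-connectivity enters (`exists_splittable_fibre`). A branch set that cannot be so
divided has a hub vertex, and each component left by removing the hub sees at most one other branch
set (`ConnOn.exists_hub`). If no branch set divides, a non-hub vertex exists because |V(G)| > 8, and
the hubs of its branch set and of one other separate it from the rest of G.

`D₁₇` is 4-regular and vertex-transitive, and permuting its columns preserves it. Counting how the
four neighbours of the split vertex are shared leaves five patterns (`hasSplitPattern`), and each
contains `E₂₀` or `K₃,₄`. -/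

namespace SimpleGraph

/-! ### Connected sets, described by cuts -/

variable {V W : Type*} {G : SimpleGraph V}

/-- The set `S` is connected in `G`, expressed through cuts: it is nonempty and no nonempty proper
subset of it is closed under adjacency inside `S`. -/
def ConnOn (G : SimpleGraph V) (S : Set V) : Prop :=
  S.Nonempty ∧ ∀ K ⊆ S, K.Nonempty → (∀ x ∈ K, ∀ y ∈ S, G.Adj x y → y ∈ K) → S ⊆ K

theorem connected_induce_iff_connOn {S : Set V} : (G.induce S).Connected ↔ G.ConnOn S := by
  constructor
  · intro h
    refine ⟨Set.nonempty_coe_sort.1 h.nonempty, fun K hKS ⟨x, hx⟩ hK y hy => ?_⟩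
    have hr := (reachable_iff_reflTransGen _ _).1 (h.preconnected ⟨x, hKS hx⟩ ⟨y, hy⟩)
    have : ∀ z : S, Relation.ReflTransGen (G.induce S).Adj ⟨x, hKS hx⟩ z → (z : V) ∈ K := by
      intro z hz
      induction hz with
      | refl => exact hx
      | tail _ hbc ih => exact hK _ ih _ (Subtype.coe_prop _) hbc
    exact this _ hr
  · rintro ⟨hne, h⟩
    have : Nonempty S := hne.to_subtype
    refine ⟨fun u v => ?_⟩
    have hsub := h {y | ∃ hy : y ∈ S, (G.induce S).Reachable u ⟨y, hy⟩} (fun y hy => hy.1)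
      ⟨u, u.2, Reachable.refl _⟩ (by
        rintro x ⟨hx, hux⟩ y hy hxy
        exact ⟨hy, hux.trans (Adj.reachable (G := G.induce S) (u := ⟨x, hx⟩) (v := ⟨y, hy⟩) hxy)⟩)
    exact (hsub v.2).2

theorem ConnOn.singleton (v : V) : G.ConnOn {v} :=
  ⟨⟨v, rfl⟩, fun K hK ⟨x, hx⟩ _ y hy => by
    have := hK hx
    simp only [Set.mem_singleton_iff] at this hy
    subst this hy
    exact hx⟩

theorem ConnOn.union {S T : Set V} (hS : G.ConnOn S) (hT : G.ConnOn T)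
    (h : ∃ x ∈ S, ∃ y ∈ T, G.Adj x y) : G.ConnOn (S ∪ T) := by
  obtain ⟨a, ha, b, hb, hab⟩ := h
  refine ⟨hS.1.mono Set.subset_union_left, fun K hK hne hcl => ?_⟩
  have h1 : ∀ x ∈ K, x ∈ S → S ⊆ K := fun x hx hxS y hy =>
    (hS.2 (K ∩ S) Set.inter_subset_right ⟨x, hx, hxS⟩
      (fun x hx y hy hxy => ⟨hcl x hx.1 y (Or.inl hy) hxy, hy⟩) hy).1
  have h2 : ∀ x ∈ K, x ∈ T → T ⊆ K := fun x hx hxT y hy =>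
    (hT.2 (K ∩ T) Set.inter_subset_right ⟨x, hx, hxT⟩
      (fun x hx y hy hxy => ⟨hcl x hx.1 y (Or.inr hy) hxy, hy⟩) hy).1
  obtain ⟨x, hx⟩ := hne
  rcases hK hx with hxS | hxT
  · have hSK := h1 x hx hxS
    exact Set.union_subset hSK (h2 b (hcl a (hSK ha) b (Or.inr hb) hab) hb)
  · have hTK := h2 x hx hxT
    exact Set.union_subset (h1 a (hcl b (hTK hb) a (Or.inl ha) hab.symm) ha) hTK

theorem ConnOn.exists_adj {S Z : Set V} (hS : G.ConnOn S) (hZ : Z ⊆ S) (hne : Z.Nonempty)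
    (hZS : Z ≠ S) : ∃ x ∈ Z, ∃ y ∈ S \ Z, G.Adj x y := by
  by_contra! h
  refine hZS (hZ.antisymm (hS.2 Z hZ hne fun x hx y hy hxy => ?_))
  by_contra hyZ
  exact h x hx y ⟨hy, hyZ⟩ hxy

/-- The connected component of a vertex inside a set. -/
theorem exists_component {A : Set V} {c : V} (hc : c ∈ A) :
    ∃ D ⊆ A, c ∈ D ∧ G.ConnOn D ∧ ∀ x ∈ D, ∀ y ∈ A, G.Adj x y → y ∈ D := by
  let D : Set V := ⋂₀ {K | K ⊆ A ∧ c ∈ K ∧ ∀ x ∈ K, ∀ y ∈ A, G.Adj x y → y ∈ K}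
  have hDA : D ⊆ A := Set.sInter_subset_of_mem ⟨subset_rfl, hc, fun _ _ y hy _ => hy⟩
  have hcD : c ∈ D := fun K hK => hK.2.1
  have hcl : ∀ x ∈ D, ∀ y ∈ A, G.Adj x y → y ∈ D :=
    fun x hx y hy hxy K hK => hK.2.2 x (hx K hK) y hy hxy
  refine ⟨D, hDA, hcD, ⟨⟨c, hcD⟩, fun K hKD hne hK => ?_⟩, hcl⟩
  by_cases hcK : c ∈ K
  · exact Set.sInter_subset_of_mem ⟨hKD.trans hDA, hcK,
      fun x hx y hy hxy => hK x hx y (hcl x (hKD hx) y hy hxy) hxy⟩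
  · have : D ⊆ D \ K := Set.sInter_subset_of_mem ⟨Set.sdiff_subset.trans hDA, ⟨hcD, hcK⟩,
      fun x hx y hy hxy => ⟨hcl x hx.1 y hy hxy, fun hyK => hx.2 (hK y hyK x hx.1 hxy.symm)⟩⟩
    obtain ⟨x, hx⟩ := hne
    exact absurd hx (this (hKD hx)).2

/-- Removing from a connected set a component of the complement of a connected subset leaves a
connected set. -/
theorem ConnOn.diff_component {A E D : Set V} (hA : G.ConnOn A) (hE : G.ConnOn E) (hEA : E ⊆ A)
    (hDE : D ⊆ A \ E) (hD : ∀ x ∈ D, ∀ y ∈ A \ E, G.Adj x y → y ∈ D) : G.ConnOn (A \ D) := by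
  have hEAD : E ⊆ A \ D := fun x hx => ⟨hEA hx, fun hxD => (hDE hxD).2 hx⟩
  obtain ⟨e, he⟩ := hE.1
  -- A closed part K of A \ D that misses E has no edge to D, since D is closed in A \ E. So K would
  -- be closed in A, hence all of A. Thus both sides of any cut of A \ D meet E, which is connected.
  have key : ∀ K ⊆ A \ D, K.Nonempty → (∀ x ∈ K, ∀ y ∈ A \ D, G.Adj x y → y ∈ K) →
      ∃ x ∈ K, x ∈ E := by
    intro K hK hne hcl
    by_contra! hKE
    have := hA.2 K (hK.trans Set.sdiff_subset) hne fun x hx y hy hxy => by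
      refine hcl x hx y ⟨hy, fun hyD => (hK hx).2 ?_⟩ hxy
      exact hD y hyD x ⟨(hK hx).1, hKE x hx⟩ hxy.symm
    exact hKE e (this (hEA he)) he
  refine ⟨⟨e, hEAD he⟩, fun K hK hne hcl y hy => ?_⟩
  obtain ⟨x, hx, hxE⟩ := key K hK hne hcl
  have hEK : E ⊆ K := fun z hz => (hE.2 (K ∩ E) Set.inter_subset_right ⟨x, hx, hxE⟩
    (fun x hx y hy hxy => ⟨hcl x hx.1 y (hEAD hy) hxy, hy⟩) hz).1
  by_contra hyK
  obtain ⟨z, hz, hzE⟩ := key ((A \ D) \ K) Set.sdiff_subset ⟨y, hy, hyK⟩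
    fun x hx y hy hxy => ⟨hy, fun hyK => hx.2 (hcl y hyK x hx.1 hxy.symm)⟩
  exact hz.2 (hEK hzE)

/-! ### Minors and covering models -/

/-- The minor relation, with connectivity of the branch sets expressed by `ConnOn`. -/
theorem isMinor_iff {H : SimpleGraph W} : H.IsMinor G ↔ ∃ μ : W → Set V,
    (∀ w, G.ConnOn (μ w)) ∧ (∀ u w, u ≠ w → Disjoint (μ u) (μ w)) ∧
    ∀ u w, H.Adj u w → ∃ x ∈ μ u, ∃ y ∈ μ w, G.Adj x y := by
  simp only [IsMinor, connected_induce_iff_connOn]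

theorem IsMinor.of_injective_hom {H : SimpleGraph W} (φ : H →g G)
    (hφ : Function.Injective φ) : H.IsMinor G :=
  isMinor_iff.2 ⟨fun w => {φ w}, fun _ => .singleton _,
    fun _ _ huw => Set.disjoint_singleton.2 (hφ.ne huw),
    fun _ _ h => ⟨_, rfl, _, rfl, φ.map_adj h⟩⟩

theorem IsMinor.trans {U : Type*} {F : SimpleGraph U} {H : SimpleGraph W} (hFH : F.IsMinor H)
    (hHG : H.IsMinor G) : F.IsMinor G := by
  obtain ⟨ν, hν, hνd, hνa⟩ := isMinor_iff.1 hFH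
  obtain ⟨μ, hμ, hμd, hμa⟩ := isMinor_iff.1 hHG
  refine isMinor_iff.2 ⟨fun u => ⋃ w ∈ ν u, μ w, fun u => ⟨?_, fun K hK hne hcl => ?_⟩,
    fun u w huw => ?_, fun u w h => ?_⟩
  · obtain ⟨w, hw⟩ := (hν u).1
    obtain ⟨x, hx⟩ := (hμ w).1
    exact ⟨x, Set.mem_biUnion hw hx⟩
  · have hfull : ∀ w ∈ ν u, ∀ x ∈ K, x ∈ μ w → μ w ⊆ K := fun w hw x hx hxw y hy =>
      ((hμ w).2 (K ∩ μ w) Set.inter_subset_right ⟨x, hx, hxw⟩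
        (fun x hx y hy hxy => ⟨hcl x hx.1 y (Set.mem_biUnion hw hy) hxy, hy⟩) hy).1
    have hsub := (hν u).2 {w | w ∈ ν u ∧ μ w ⊆ K} (fun w hw => hw.1) (by
      obtain ⟨x, hx⟩ := hne
      obtain ⟨w, hw, hxw⟩ := Set.mem_iUnion₂.1 (hK hx)
      exact ⟨w, hw, hfull w hw x hx hxw⟩) (by
      rintro w ⟨hw, hwK⟩ w' hw' hadj
      obtain ⟨x, hx, y, hy, hxy⟩ := hμa _ _ hadj
      exact ⟨hw', hfull w' hw' y (hcl x (hwK hx) y (Set.mem_biUnion hw' hy) hxy) hy⟩)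
    exact Set.iUnion₂_subset fun w hw => (hsub hw).2
  · simp only [Set.disjoint_iUnion_left, Set.disjoint_iUnion_right]
    exact fun i hi j hj => hμd _ _ fun hij => Set.disjoint_left.1 (hνd u w huw) hj (hij ▸ hi)
  · obtain ⟨a, ha, b, hb, hab⟩ := hνa u w h
    obtain ⟨x, hx, y, hy, hxy⟩ := hμa a b hab
    exact ⟨x, Set.mem_biUnion ha hx, y, Set.mem_biUnion hb hy, hxy⟩

/-- The branch sets of a minor of a connected graph can be enlarged to cover all vertices. -/
theorem IsMinor.exists_covering [Finite V] [Nonempty W] {H : SimpleGraph W}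
    (hG : G.ConnOn Set.univ) (h : H.IsMinor G) :
    ∃ f : V → W, (∀ w, G.ConnOn {v | f v = w}) ∧
      ∀ u w, H.Adj u w → ∃ x y, f x = u ∧ f y = w ∧ G.Adj x y := by
  classical
  let P : (W → Set V) → Prop := fun μ =>
    (∀ w, G.ConnOn (μ w)) ∧ (∀ u w, u ≠ w → Disjoint (μ u) (μ w)) ∧
    ∀ u w, H.Adj u w → ∃ x ∈ μ u, ∃ y ∈ μ w, G.Adj x y
  have hex : ∃ N : Set V, ∃ μ, P μ ∧ ⋃ w, μ w = N := by
    obtain ⟨μ, hμ⟩ := isMinor_iff.1 h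
    exact ⟨_, μ, hμ, rfl⟩
  obtain ⟨N, hN⟩ := Set.Finite.exists_maximal
    (Set.toFinite {N : Set V | ∃ μ, P μ ∧ ⋃ w, μ w = N}) hex
  obtain ⟨⟨μ, ⟨hc, hd, ha⟩, hμN⟩, hmax⟩ := hN
  have huniv : N = Set.univ := by
    by_contra hne
    have hNne : N.Nonempty := by
      obtain ⟨w⟩ := ‹Nonempty W›
      obtain ⟨x, hx⟩ := (hc w).1
      exact ⟨x, hμN ▸ Set.mem_iUnion.2 ⟨w, hx⟩⟩
    obtain ⟨x, hx, y, hy, hxy⟩ := hG.exists_adj (Set.subset_univ N) hNne hne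
    obtain ⟨w, hw⟩ := Set.mem_iUnion.1 (hμN ▸ hx)
    have hyμ : ∀ u, y ∉ μ u := fun u hu => hy.2 (hμN ▸ Set.mem_iUnion.2 ⟨u, hu⟩)
    let μ' : W → Set V := fun u => if u = w then μ u ∪ {y} else μ u
    have hle : ∀ u, μ u ⊆ μ' u := fun u => by
      by_cases hu : u = w <;> simp [μ', hu]
    have hP : P μ' := by
      refine ⟨fun u => ?_, fun u v huv => ?_, fun u v huv => ?_⟩
      · by_cases hu : u = w
        · subst hu
          simpa [μ'] using (hc u).union (.singleton y) ⟨x, hw, y, rfl, hxy⟩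
        · simpa [μ', hu] using hc u
      · have := hd u v huv
        by_cases hu : u = w <;> by_cases hv : v = w
        · exact absurd (hu.trans hv.symm) huv
        · simpa [μ', hu, hv, hyμ] using hu ▸ this
        · simpa [μ', hu, hv, hyμ] using hv ▸ this
        · simpa [μ', hu, hv] using this
      · obtain ⟨a, ha, b, hb, hab⟩ := ha u v huv
        exact ⟨a, hle u ha, b, hle v hb, hab⟩
    have := hmax ⟨μ', hP, rfl⟩ (by
      rw [← hμN]
      exact Set.iUnion_mono hle)
    exact hy.2 (this (Set.mem_iUnion.2 ⟨w, by simp [μ']⟩))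
  have hcov : ∀ v, ∃ w, v ∈ μ w := fun v => Set.mem_iUnion.1 (hμN ▸ huniv ▸ Set.mem_univ v)
  choose f hf using hcov
  have hfib : ∀ w v, v ∈ μ w ↔ f v = w := fun w v => by
    refine ⟨fun hv => ?_, fun hv => hv ▸ hf v⟩
    by_contra hne
    exact Set.disjoint_left.1 (hd _ _ hne) (hf v) hv
  refine ⟨f, fun w => ?_, fun u w huw => ?_⟩
  · convert hc w using 1
    ext v
    exact (hfib w v).symm
  · obtain ⟨x, hx, y, hy, hxy⟩ := ha u w huw
    exact ⟨x, y, (hfib _ _).1 hx, (hfib _ _).1 hy, hxy⟩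

end SimpleGraph

/-! ### Dividing a branch set -/

namespace SimpleGraph

variable {V W : Type*} {G : SimpleGraph V}

/-- Let `B` be a connected set whose vertices see at least four colours altogether. If `B` cannot be
divided into two connected parts each seeing at least two colours, then there is a vertex `v` in `B`
such that every connected subset of `B` that avoids `v` sees at most one colour. -/
theorem ConnOn.exists_hub [Finite V] [Finite W] {B : Set V} (hB : G.ConnOn B) (t : V → Set W)
    (h4 : 4 ≤ (⋃ x ∈ B, t x).ncard)
    (hns : ∀ X ⊆ B, G.ConnOn X → G.ConnOn (B \ X) → 2 ≤ (⋃ x ∈ X, t x).ncard →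
      (⋃ x ∈ B \ X, t x).ncard ≤ 1) :
    ∃ v ∈ B, ∀ C ⊆ B \ {v}, G.ConnOn C → (⋃ x ∈ C, t x).ncard ≤ 1 := by
  have hmono : ∀ {C D : Set V}, C ⊆ D → (⋃ x ∈ C, t x).ncard ≤ (⋃ x ∈ D, t x).ncard :=
    fun h => Set.ncard_le_ncard (Set.biUnion_subset_biUnion_left h) (Set.toFinite _)
  have hunion : ∀ C D : Set V, (⋃ x ∈ C ∪ D, t x).ncard ≤
      (⋃ x ∈ C, t x).ncard + (⋃ x ∈ D, t x).ncard := fun C D => by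
    rw [Set.biUnion_union]
    exact Set.ncard_union_le _ _
  have htotal : ∀ C ⊆ B, 4 ≤ (⋃ x ∈ C, t x).ncard + (⋃ x ∈ B \ C, t x).ncard := fun C hC => by
    have := hunion C (B \ C)
    rw [Set.union_sdiff_cancel hC] at this
    omega
  -- Allowing an empty complement makes B itself a candidate. The hub is any vertex of a minimal X,
  -- chosen with a neighbour outside X if X ≠ B.
  obtain ⟨X, ⟨hXB, hX, hY, hX2⟩, hmin⟩ := Set.Finite.exists_minimal
    (Set.toFinite {X : Set V | X ⊆ B ∧ G.ConnOn X ∧ (B \ X = ∅ ∨ G.ConnOn (B \ X)) ∧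
      2 ≤ (⋃ x ∈ X, t x).ncard}) ⟨B, subset_rfl, hB, Or.inl (Set.sdiff_self), by omega⟩
  have hsmall : ∀ D ⊆ X, D ≠ X → G.ConnOn D → G.ConnOn (B \ D) → (⋃ x ∈ D, t x).ncard ≤ 1 := by
    intro D hDX hne hD hBD
    by_contra! hlt
    exact hne (hDX.antisymm (hmin ⟨hDX.trans hXB, hD, Or.inr hBD, hlt⟩ hDX))
  obtain ⟨v, hvX, hv⟩ : ∃ v ∈ X, (B \ X).Nonempty → ∃ y ∈ B \ X, G.Adj v y := by
    by_cases hXB' : X = B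
    · obtain ⟨v, hv⟩ := hX.1
      exact ⟨v, hv, fun ⟨y, hy⟩ => absurd (hXB' ▸ hy.1) hy.2⟩
    · obtain ⟨v, hv, y, hy, hvy⟩ := hB.exists_adj hXB hX.1 hXB'
      exact ⟨v, hv, fun _ => ⟨y, hy, hvy⟩⟩
  refine ⟨v, hXB hvX, fun C₀ hC₀ hC₀c => ?_⟩
  obtain ⟨c₀, hc₀⟩ := hC₀c.1
  obtain ⟨C, hCB, hc₀C, hC, hCcl⟩ := exists_component (G := G) (hC₀ hc₀)
  have hC₀C : C₀ ⊆ C := fun y hy => (hC₀c.2 (C ∩ C₀) Set.inter_subset_right ⟨c₀, hc₀C, hc₀⟩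
    (fun x hx y hy hxy => ⟨hCcl x hx.1 y (hC₀ hy) hxy, hy⟩) hy).1
  refine (hmono hC₀C).trans ?_
  have hvC : v ∉ C := fun h => (hCB h).2 rfl
  have hCB' : C ⊆ B := hCB.trans Set.sdiff_subset
  have hBC : G.ConnOn (B \ C) :=
    hB.diff_component (.singleton v) (Set.singleton_subset_iff.2 (hXB hvX)) hCB hCcl
  -- A component C of B minus v inside X is handled by minimality. Any other contains all of B \ X,
  -- which is connected and avoids v.
  by_cases hCX : C ⊆ X
  · exact hsmall C hCX (fun h => hvC (h ▸ hvX)) hC hBC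
  obtain ⟨y₀, hy₀C, hy₀X⟩ := Set.not_subset.1 hCX
  have hYne : (B \ X).Nonempty := ⟨y₀, hCB' hy₀C, hy₀X⟩
  replace hY : G.ConnOn (B \ X) := hY.resolve_left hYne.ne_empty
  have hYC : B \ X ⊆ C := fun y hy => (hY.2 (C ∩ (B \ X)) Set.inter_subset_right
    ⟨y₀, hy₀C, hCB' hy₀C, hy₀X⟩ (fun x hx y hy hxy =>
      ⟨hCcl x hx.1 y ⟨hy.1, fun h => hy.2 (h ▸ hvX)⟩ hxy, hy⟩) hy).1
  have hXX : B \ (B \ X) = X := Set.sdiff_sdiff_cancel_left hXB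
  by_contra! hC2
  -- Grow B \ X inside C while it sees at most one colour. The next piece D also sees at most one,
  -- by minimality of X. By maximality of Z, Z ∪ D sees at least two, so its complement sees at most
  -- one, giving at most three colours in total.
  obtain ⟨Z, ⟨hYZ, hZC, hZ, hBZ, hZ1⟩, hmax⟩ := Set.Finite.exists_maximal
    (Set.toFinite {Z : Set V | B \ X ⊆ Z ∧ Z ⊆ C ∧ G.ConnOn Z ∧ G.ConnOn (B \ Z) ∧
      (⋃ x ∈ Z, t x).ncard ≤ 1})
    ⟨B \ X, subset_rfl, hYC, hY, hXX.symm ▸ hX, hns X hXB hX hY hX2⟩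
  obtain ⟨z, hz, c, hc, hzc⟩ := hC.exists_adj hZC hZ.1 (fun h => by subst h; omega)
  obtain ⟨D, hDC, hcD, hD, hDcl⟩ := exists_component (G := G) hc
  have hAE : (B \ Z) \ (B \ C) = C \ Z := by
    ext x
    have := @hCB' x
    simp only [Set.mem_sdiff]
    tauto
  have hAD : G.ConnOn ((B \ Z) \ D) := hBZ.diff_component hBC (Set.sdiff_subset_sdiff_right hZC)
    (hAE ▸ hDC) (hAE ▸ hDcl)
  have hZD : G.ConnOn (Z ∪ D) := hZ.union hD ⟨z, hz, c, hcD, hzc⟩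
  have hDB : B \ D = Z ∪ ((B \ Z) \ D) := by
    ext x
    have h1 := @hDC x
    have h2 := @hCB' x
    have h3 := @hZC x
    simp only [Set.mem_sdiff, Set.mem_union] at *
    tauto
  have hvD : v ∉ D := fun h => hvC (hDC h).1
  have hBD : G.ConnOn (B \ D) := by
    obtain ⟨y, hy, hvy⟩ := hv hYne
    rw [hDB]
    exact hZ.union hAD ⟨y, hYZ hy, v, ⟨⟨hXB hvX, fun h => hvC (hZC h)⟩, hvD⟩, hvy.symm⟩
  have hDX : D ⊆ X := fun x hx => by
    by_contra hxX
    exact (hDC hx).2 (hYZ ⟨hCB' (hDC hx).1, hxX⟩)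
  have hD1 := hsmall D hDX (fun h => hvD (h ▸ hvX)) hD hBD
  have hZDC : Z ∪ D ⊆ C := Set.union_subset hZC (hDC.trans Set.sdiff_subset)
  have h2 := hunion Z D
  rw [Set.sdiff_sdiff] at hAD
  by_cases h1 : (⋃ x ∈ Z ∪ D, t x).ncard ≤ 1
  · exact hc.2 (hmax ⟨hYZ.trans Set.subset_union_left, hZDC, hZD, hAD, h1⟩
      Set.subset_union_left (Or.inr hcD))
  · have h3 := hns (Z ∪ D) (hZDC.trans hCB') hZD hAD (by omega)
    have h4 := htotal (Z ∪ D) (hZDC.trans hCB')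
    omega

/-- In a 3-connected graph with more vertices than a minor `H` of minimum degree at least four, some
covering model of `H` has a branch set that divides into two connected parts, each adjacent to at
least two other branch sets. -/
theorem exists_splittable_fibre [Finite V] [Finite W] {H : SimpleGraph W} [Nonempty W]
    (hG : G.IsKConnected 3) (hdeg : ∀ w, 4 ≤ (H.neighborSet w).ncard)
    (hcard : Nat.card W < Nat.card V) (f : V → W) (hf : ∀ w, G.ConnOn {v | f v = w})
    (hadj : ∀ u w, H.Adj u w → ∃ x y, f x = u ∧ f y = w ∧ G.Adj x y) :
    ∃ w, ∃ X ⊆ {v | f v = w}, G.ConnOn X ∧ G.ConnOn ({v | f v = w} \ X) ∧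
      2 ≤ (⋃ x ∈ X, {u | u ≠ f x ∧ ∃ y, f y = u ∧ G.Adj x y}).ncard ∧
      2 ≤ (⋃ x ∈ {v | f v = w} \ X, {u | u ≠ f x ∧ ∃ y, f y = u ∧ G.Adj x y}).ncard := by
  set t : V → Set W := fun x => {u | u ≠ f x ∧ ∃ y, f y = u ∧ G.Adj x y} with ht
  by_contra! hcon
  have hhub : ∀ w, ∃ v, f v = w ∧ ∀ C ⊆ {v | f v = w} \ {v}, G.ConnOn C →
      (⋃ x ∈ C, t x).ncard ≤ 1 := fun w =>
    (hf w).exists_hub t ((hdeg w).trans (Set.ncard_le_ncard (fun u hu => by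
      obtain ⟨x, y, hx, hy, hxy⟩ := hadj _ _ hu
      refine Set.mem_biUnion (x := x) hx ⟨?_, y, hy, hxy⟩
      rw [hx]
      exact (H.ne_of_adj hu).symm) (Set.toFinite _)))
      fun X hX hXc hYc h2 => Nat.le_of_lt_succ (hcon w X hX hXc hYc h2)
  choose hub hfhub hhub using hhub
  obtain ⟨x₀, hx₀⟩ : ∃ x, hub (f x) ≠ x := by
    by_contra! h
    exact hcard.not_ge (Nat.card_le_card_of_injective f (Function.LeftInverse.injective h))
  have hmem : ∀ w x, f x = w → x ≠ hub w → x ∈ {v | f v = w} \ {hub w} := fun w x h h' => ⟨h, h'⟩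
  obtain ⟨K, hKs, hx₀K, hK, hKcl⟩ := exists_component (G := G) (hmem _ _ rfl hx₀.symm)
  have hle1 : ∀ S : Set W, S.ncard ≤ 1 → ∀ a ∈ S, ∀ b ∈ S, a = b := fun S hS =>
    (Set.ncard_le_one (Set.toFinite _)).1 hS
  -- If K sees no other fibre, any neighbour of `f x₀` in H serves as j.
  obtain ⟨j, hjne, hj⟩ : ∃ j, j ≠ f x₀ ∧ (⋃ x ∈ K, t x) ⊆ {j} := by
    rcases (⋃ x ∈ K, t x).eq_empty_or_nonempty with h | ⟨j, hj⟩
    · have : (H.neighborSet (f x₀)).Nonempty := by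
        rw [← Set.ncard_pos]
        exact lt_of_lt_of_le (by norm_num) (hdeg _)
      obtain ⟨j, hj⟩ := this
      exact ⟨j, (H.ne_of_adj hj).symm, by simp [h]⟩
    · refine ⟨j, ?_, fun u hu => hle1 _ (hhub _ K hKs hK) _ hu _ hj⟩
      obtain ⟨x, hx, hjx⟩ := Set.mem_iUnion₂.1 hj
      have h1 : f x = f x₀ := (hKs hx).1
      exact h1 ▸ hjx.1
  -- the vertices all of whose connected neighbourhoods in their fibre see at most the fibre `b`
  let Q : W → V → Prop := fun b y =>
    y ≠ hub (f y) ∧ ∀ C ⊆ {v | f v = f y} \ {hub (f y)}, G.ConnOn C → y ∈ C → (⋃ x ∈ C, t x) ⊆ {b}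
  -- An edge leaving a component of fibre a minus its hub can only reach fibre b. The component it
  -- enters there sees a, hence sees nothing else.
  have hQ : ∀ a b, ∀ y z, f y = a → Q b y → G.Adj y z → z ≠ hub a → z ≠ hub b →
      (f z = a ∧ Q b z) ∨ (f z = b ∧ Q a z) := by
    rintro a b y z rfl ⟨hy, hQy⟩ hyz hza hzb
    by_cases hz : f z = f y
    · refine Or.inl ⟨hz, hz ▸ hza, fun C hC hCc hzC => ?_⟩
      rw [hz] at hC
      refine subset_trans ?_ (hQy (C ∪ {y}) (Set.union_subset hC
        (Set.singleton_subset_iff.2 (hmem _ _ rfl hy))) (hCc.union (.singleton y)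
        ⟨z, hzC, y, rfl, hyz.symm⟩) (Or.inr rfl))
      exact Set.biUnion_subset_biUnion_left Set.subset_union_left
    · have hzb' : f z = b := hQy {y} (Set.singleton_subset_iff.2 (hmem _ _ rfl hy)) (.singleton y)
        rfl (Set.mem_biUnion (x := y) rfl ⟨hz, z, rfl, hyz⟩)
      subst hzb'
      refine Or.inr ⟨rfl, hzb, fun C hC hCc hzC u hu => ?_⟩
      exact hle1 _ (hhub _ C hC hCc) _ hu _
        (Set.mem_biUnion hzC ⟨fun h => hz h.symm, y, rfl, hyz.symm⟩)
  let R : Set V := {y | (f y = f x₀ ∧ Q j y) ∨ (f y = j ∧ Q (f x₀) y)}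
  have hcut := connected_induce_iff_connOn.1 (hG.2 {hub (f x₀), hub j}
    (lt_of_le_of_lt (Set.ncard_insert_le _ _) (by simp)))
  have hRsub : R ⊆ ({hub (f x₀), hub j} : Set V)ᶜ := by
    rintro y hy (h | h)
    · subst h
      rcases hy with ⟨h1, h2⟩ | ⟨h1, h2⟩ <;> rw [hfhub] at h1
      · exact h2.1 (by rw [hfhub])
      · exact hjne h1.symm
    · rw [Set.mem_singleton_iff] at h
      subst h
      rcases hy with ⟨h1, h2⟩ | ⟨h1, h2⟩ <;> rw [hfhub] at h1
      · exact hjne h1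
      · exact h2.1 (by rw [hfhub])
  have hall := hcut.2 R hRsub ⟨x₀, Or.inl ⟨rfl, hx₀.symm, fun C hC hCc hxC => ?_⟩⟩ ?_
  -- R lies in two fibres, so the hub of a third fibre contradicts that R is everything outside the
  -- two hubs.
  · have hdeg' : ∃ u, u ≠ f x₀ ∧ u ≠ j := by
      by_contra! h
      have h1 : H.neighborSet (f x₀) ⊆ {j} := fun u hu => h u (H.ne_of_adj hu).symm
      have h2 := (hdeg (f x₀)).trans (Set.ncard_le_ncard h1 (Set.toFinite _))
      simp at h2
    obtain ⟨u, hu1, hu2⟩ := hdeg'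
    have hR : hub u ∈ R := hall (by
      rintro (h | h)
      · exact hu1 (by rw [← hfhub u, h, hfhub])
      · rw [Set.mem_singleton_iff] at h
        exact hu2 (by rw [← hfhub u, h, hfhub]))
    rcases hR with ⟨h, -⟩ | ⟨h, -⟩ <;> rw [hfhub] at h
    · exact hu1 h
    · exact hu2 h
  · refine subset_trans (Set.biUnion_subset_biUnion_left fun y hy => ?_) hj
    exact (hCc.2 (K ∩ C) Set.inter_subset_right ⟨x₀, hx₀K, hxC⟩
      (fun x hx y hy hxy => ⟨hKcl x hx.1 y (hC hy) hxy, hy⟩) hy).1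
  · intro y hy z hz hyz
    have hz1 : z ≠ hub (f x₀) := fun h => hz (Or.inl h)
    have hz2 : z ≠ hub j := fun h => hz (Or.inr h)
    rcases hy with ⟨h1, h2⟩ | ⟨h1, h2⟩
    · exact hQ _ _ y z h1 h2 hyz hz1 hz2
    · exact (hQ _ _ y z h1 h2 hyz hz2 hz1).symm

end SimpleGraph

/-! ### Vertex splits as minors -/

namespace SimpleGraph

variable {V W : Type*} {G : SimpleGraph V}

/-- Branch sets with at most two vertices: that of `w` is `{a w, b w}`. -/
theorem IsMinor.of_pairs {H : SimpleGraph W} (a b : W → V)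
    (hab : ∀ w, a w = b w ∨ G.Adj (a w) (b w))
    (hne : ∀ u w, u ≠ w → a u ≠ a w ∧ a u ≠ b w ∧ b u ≠ b w)
    (hadj : ∀ u w, H.Adj u w →
      G.Adj (a u) (a w) ∨ G.Adj (a u) (b w) ∨ G.Adj (b u) (a w) ∨ G.Adj (b u) (b w)) :
    H.IsMinor G := by
  refine isMinor_iff.2 ⟨fun w => {a w, b w}, fun w => ?_, fun u w huw => ?_, fun u w h => ?_⟩
  · rcases hab w with h | h
    · simpa [h] using ConnOn.singleton (b w)
    · exact (ConnOn.singleton (a w)).union (.singleton (b w)) ⟨_, rfl, _, rfl, h⟩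
  · obtain ⟨h1, h2, h3⟩ := hne u w huw
    have h4 := (hne w u huw.symm).2.1.symm
    simp [h1.symm, h2.symm, h3.symm, h4.symm]
  · rcases hadj u w h with h | h | h | h
    · exact ⟨_, Or.inl rfl, _, Or.inl rfl, h⟩
    · exact ⟨_, Or.inl rfl, _, Or.inr rfl, h⟩
    · exact ⟨_, Or.inr rfl, _, Or.inl rfl, h⟩
    · exact ⟨_, Or.inr rfl, _, Or.inr rfl, h⟩

/-- The graph obtained from `H` by splitting the vertex `w` into two adjacent vertices `none`, with
further neighbours `S`, and `some w`, with further neighbours `T`. -/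
def splitVertex (H : SimpleGraph W) (w : W) (S T : Finset W) : SimpleGraph (Option W) :=
  SimpleGraph.fromRel fun
    | none, some u => u = w ∨ u ∈ S
    | some u, some v => (u ≠ w ∧ v ≠ w ∧ H.Adj u v) ∨ (u = w ∧ v ∈ T)
    | _, none => False

instance splitVertexDecidable [DecidableEq W] (H : SimpleGraph W) [DecidableRel H.Adj] (w : W)
    (S T : Finset W) : DecidableRel (H.splitVertex w S T).Adj := fun a b =>
  match a, b with
  | none, none => decidable_of_iff False (by simp)
  | none, some u => decidable_of_iff (u = w ∨ u ∈ S) (by simp [splitVertex])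
  | some u, none => decidable_of_iff (u = w ∨ u ∈ S) (by simp [splitVertex])
  | some u, some v => decidable_of_iff (u ≠ v ∧
      (((u ≠ w ∧ v ≠ w ∧ H.Adj u v) ∨ (u = w ∧ v ∈ T)) ∨
        ((v ≠ w ∧ u ≠ w ∧ H.Adj v u) ∨ (v = w ∧ u ∈ T)))) (by simp [splitVertex])

theorem isMinor_fromRel {r : W → W → Prop} (μ : W → Set V) (hc : ∀ w, G.ConnOn (μ w))
    (hd : ∀ u w, u ≠ w → Disjoint (μ u) (μ w))
    (ha : ∀ u w, r u w → ∃ x ∈ μ u, ∃ y ∈ μ w, G.Adj x y) :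
    (SimpleGraph.fromRel r).IsMinor G := by
  refine isMinor_iff.2 ⟨μ, hc, hd, ?_⟩
  rintro u w ⟨-, h | h⟩
  · exact ha u w h
  · obtain ⟨x, hx, y, hy, hxy⟩ := ha w u h
    exact ⟨y, hy, x, hx, hxy.symm⟩

/-- S and T may contain vertices not adjacent to w in H, because fibres of G can be adjacent without
their indices being so. The patterns with extra edges need this freedom. -/
theorem splitVertex_isMinor {H : SimpleGraph W} (f : V → W) (hf : ∀ w, G.ConnOn {v | f v = w})
    (hadj : ∀ u w, H.Adj u w → ∃ x y, f x = u ∧ f y = w ∧ G.Adj x y) {w : W} {X Y : Set V}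
    (hXY : X ∪ Y = {v | f v = w}) (hd : Disjoint X Y) (hX : G.ConnOn X) (hY : G.ConnOn Y)
    {S T : Finset W} (hS : ∀ s ∈ S, ∃ x ∈ X, ∃ y, f y = s ∧ s ≠ w ∧ G.Adj x y)
    (hT : ∀ s ∈ T, ∃ x ∈ Y, ∃ y, f y = s ∧ s ≠ w ∧ G.Adj x y) :
    (H.splitVertex w S T).IsMinor G := by
  classical
  have hXw : ∀ x ∈ X, f x = w := fun x hx => hXY.subset (Or.inl hx)
  have hYw : ∀ x ∈ Y, f x = w := fun x hx => hXY.subset (Or.inr hx)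
  let ν : W → Set V := fun u => if u = w then Y else {v | f v = u}
  have hνw : ν w = Y := if_pos rfl
  have hνu : ∀ u, u ≠ w → ν u = {v | f v = u} := fun u hu => if_neg hu
  have hνf : ∀ u, ∀ x ∈ ν u, f x = u := fun u x hx => by
    by_cases hu : u = w
    · subst hu
      exact hYw x (hνw ▸ hx)
    · rwa [hνu u hu] at hx
  have hνc : ∀ u, G.ConnOn (ν u) := fun u => by
    by_cases hu : u = w
    · subst hu
      rwa [hνw]
    · exact (hνu u hu).symm ▸ hf u
  have hYν : ∀ x ∈ Y, x ∈ ν w := fun x hx => hνw.symm ▸ hx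
  have hfν : ∀ x, f x ≠ w → x ∈ ν (f x) := fun x hx => (hνu _ hx).symm ▸ rfl
  have hXν : ∀ u, Disjoint X (ν u) := fun u => by
    by_cases hu : u = w
    · subst hu
      rwa [hνw]
    · exact Set.disjoint_left.2 fun x hx hxu => hu ((hνf u x hxu).symm.trans (hXw x hx))
  refine isMinor_fromRel (fun o => o.elim X ν) ?_ ?_ ?_
  · rintro (_ | u)
    · exact hX
    · exact hνc u
  · rintro (_ | u) (_ | v) huv
    · exact absurd rfl huv
    · exact hXν v
    · exact (hXν u).symm
    · exact Set.disjoint_left.2 fun x hx hx' =>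
        huv (congrArg some ((hνf u x hx).symm.trans (hνf v x hx')))
  · rintro (_ | u) (_ | v) h
    · exact h.elim
    · rcases h with h | h
      · subst h
        -- Y is nonempty, so X is a proper part of a connected fibre, and some edge joins X to Y.
        have hne : X ≠ {x | f x = v} := fun h => by
          obtain ⟨y, hy⟩ := hY.1
          exact Set.disjoint_left.1 hd (h ▸ hYw y hy) hy
        obtain ⟨x, hx, y, ⟨hy, hyX⟩, hxy⟩ := (hf v).exists_adj (fun x hx => hXw x hx) hX.1 hne
        rw [← hXY] at hy
        exact ⟨x, hx, y, hYν y (hy.resolve_left hyX), hxy⟩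
      · obtain ⟨x, hx, y, rfl, hne, hxy⟩ := hS v h
        exact ⟨x, hx, y, hfν y hne, hxy⟩
    · exact h.elim
    · rcases h with ⟨hu, hv, h⟩ | ⟨rfl, h⟩
      · obtain ⟨x, y, rfl, rfl, hxy⟩ := hadj u v h
        exact ⟨x, hfν x hu, y, hfν y hv, hxy⟩
      · obtain ⟨x, hx, y, rfl, hne, hxy⟩ := hT v h
        exact ⟨x, hYν x hx, y, hfν y hne, hxy⟩

end SimpleGraph

/-! ### Splitting a vertex of `D₁₇` -/

instance graphD17Decidable : DecidableRel graphD17.Adj := fun a b =>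
  decidable_of_iff ((a.1 = b.1 ∧ a.2 ≠ b.2) ∨ (a.1 ≠ b.1 ∧ a.2 = b.2)) Iff.rfl

instance graphE20Decidable : DecidableRel graphE20.Adj := by
  unfold graphE20
  infer_instance

/-- Up to symmetry, the minimal ways to split the vertex `(0, 0)` of a graph that contains `D₁₇`:
the further neighbours of the two parts. -/
def splitPatterns : List (Finset (Fin 2 × Fin 4) × Finset (Fin 2 × Fin 4)) :=
  [({(0, 1), (0, 2)}, {(0, 3), (1, 0)}),
   ({(1, 0), (1, 1)}, {(0, 1), (0, 2), (0, 3)}),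
   ({(0, 1), (1, 1)}, {(0, 2), (0, 3), (1, 0)}),
   ({(0, 1), (1, 2)}, {(0, 2), (0, 3), (1, 0)}),
   ({(1, 1), (1, 2)}, {(0, 1), (0, 2), (0, 3), (1, 0)})]

set_option maxRecDepth 10000 in
-- The first three patterns contain `E₂₀` as a spanning subgraph. The last two yield `K₃,₄` after
-- contracting two edges.
theorem isMinor_splitVertex_of_mem_splitPatterns :
    ∀ ST ∈ splitPatterns,
      (completeBipartiteGraph (Fin 3) (Fin 4)).IsMinor (graphD17.splitVertex (0, 0) ST.1 ST.2) ∨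
        graphE20.IsMinor (graphD17.splitVertex (0, 0) ST.1 ST.2) := by
  simp only [splitPatterns, List.forall_mem_cons]
  refine ⟨Or.inr ?_, Or.inr ?_, Or.inr ?_, Or.inl ?_, Or.inl ?_, by simp⟩
  · exact .of_pairs
      ![some (1, 3), some (1, 0), some (1, 1), some (1, 2), some (0, 3), some (0, 0),
        some (0, 1), some (0, 2), none]
      ![some (1, 3), some (1, 0), some (1, 1), some (1, 2), some (0, 3), some (0, 0),
        some (0, 1), some (0, 2), none] (by decide) (by decide) (by decide)
  · exact .of_pairs
      ![some (0, 1), some (0, 2), some (0, 3), some (0, 0), some (1, 1), some (1, 2),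
        some (1, 3), none, some (1, 0)]
      ![some (0, 1), some (0, 2), some (0, 3), some (0, 0), some (1, 1), some (1, 2),
        some (1, 3), none, some (1, 0)] (by decide) (by decide) (by decide)
  · exact .of_pairs
      ![some (1, 0), some (1, 1), some (1, 2), some (1, 3), some (0, 0), none, some (0, 2),
        some (0, 3), some (0, 1)]
      ![some (1, 0), some (1, 1), some (1, 2), some (1, 3), some (0, 0), none, some (0, 2),
        some (0, 3), some (0, 1)] (by decide) (by decide) (by decide)
  · exact .of_pairs
      (Sum.elim ![some (0, 1), some (1, 2), some (0, 0)]
        ![some (0, 2), some (0, 3), some (1, 0), none])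
      (Sum.elim ![some (0, 1), some (1, 2), some (0, 0)]
        ![some (0, 2), some (1, 3), some (1, 1), none]) (by decide) (by decide)
      (by simp only [completeBipartiteGraph_adj]; decide)
  · exact .of_pairs
      (Sum.elim ![some (0, 2), some (1, 1), some (0, 0)]
        ![some (0, 1), some (0, 3), some (1, 0), none])
      (Sum.elim ![some (1, 2), some (1, 3), some (0, 0)]
        ![some (0, 1), some (0, 3), some (1, 0), none]) (by decide) (by decide)
      (by simp only [completeBipartiteGraph_adj]; decide)

/-- Some pattern of `splitPatterns` occurs, up to a permutation of the columns fixing the first. -/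
def HasSplitPattern (P Q : Fin 2 × Fin 4 → Prop) : Prop :=
  ∃ p : Equiv.Perm (Fin 4), p 0 = 0 ∧ ∃ ST ∈ splitPatterns,
    (∀ s ∈ ST.1, P (s.1, p s.2)) ∧ ∀ s ∈ ST.2, Q (s.1, p s.2)

theorem exists_perm_of_nodup : ∀ k l m : Fin 4, [0, k, l, m].Nodup →
    ∃ p : Equiv.Perm (Fin 4), p 0 = 0 ∧ p 1 = k ∧ p 2 = l ∧ p 3 = m := by
  decide

theorem hasSplitPattern_of_columns {P Q : Fin 2 × Fin 4 → Prop} {k l m : Fin 4}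
    (h : [0, k, l, m].Nodup)
    (hPQ : (P (0, k) ∧ P (0, l) ∧ Q (0, m) ∧ Q (1, 0)) ∨
      (P (1, 0) ∧ P (1, k) ∧ Q (0, k) ∧ Q (0, l) ∧ Q (0, m)) ∨
      (P (0, k) ∧ P (1, k) ∧ Q (0, l) ∧ Q (0, m) ∧ Q (1, 0)) ∨
      (P (0, k) ∧ P (1, l) ∧ Q (0, l) ∧ Q (0, m) ∧ Q (1, 0)) ∨
      (P (1, k) ∧ P (1, l) ∧ Q (0, k) ∧ Q (0, l) ∧ Q (0, m) ∧ Q (1, 0))) :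
    HasSplitPattern P Q := by
  obtain ⟨p, h0, h1, h2, h3⟩ := exists_perm_of_nodup k l m h
  refine ⟨p, h0, ?_⟩
  simpa [splitPatterns, h0, h1, h2, h3, and_assoc] using hPQ

theorem eq_of_ne_of_nodup : ∀ k l m : Fin 4, [0, k, l, m].Nodup → ∀ z : Fin 2 × Fin 4,
    z ≠ (0, 0) → z ≠ (0, k) →
    z = (0, l) ∨ z = (0, m) ∨ z = (1, 0) ∨ z = (1, k) ∨ z = (1, l) ∨ z = (1, m) := by
  decide

/-- One part has a single assigned neighbour, in the row of the split vertex. If its second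
neighbour z is adjacent to (0, 0) in `D₁₇`, the four neighbours can be shared two and two; otherwise
z lies in the other row, and only whether it is in column k matters. -/
theorem hasSplitPattern_of_row {P Q : Fin 2 × Fin 4 → Prop} {k l m : Fin 4}
    (h : [0, k, l, m].Nodup) (hk : P (0, k)) (hl : Q (0, l)) (hm : Q (0, m)) (h0 : Q (1, 0))
    {z : Fin 2 × Fin 4} (hz : P z) (hz0 : z ≠ (0, 0)) (hzk : z ≠ (0, k)) :
    HasSplitPattern P Q ∨ HasSplitPattern Q P := by
  have hkml : [0, k, m, l].Nodup := by simp at h ⊢; tauto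
  have hlmk : [0, l, m, k].Nodup := by simp at h ⊢; tauto
  rcases eq_of_ne_of_nodup k l m h z hz0 hzk with rfl | rfl | rfl | rfl | rfl | rfl
  · exact Or.inl (hasSplitPattern_of_columns h (Or.inl ⟨hk, hz, hm, h0⟩))
  · exact Or.inl (hasSplitPattern_of_columns hkml (Or.inl ⟨hk, hz, hl, h0⟩))
  · exact Or.inr (hasSplitPattern_of_columns hlmk (Or.inl ⟨hl, hm, hk, hz⟩))
  · exact Or.inl (hasSplitPattern_of_columns h (Or.inr (Or.inr (Or.inl ⟨hk, hz, hl, hm, h0⟩))))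
  · exact Or.inl (hasSplitPattern_of_columns h
      (Or.inr (Or.inr (Or.inr (Or.inl ⟨hk, hz, hl, hm, h0⟩)))))
  · exact Or.inl (hasSplitPattern_of_columns hkml
      (Or.inr (Or.inr (Or.inr (Or.inl ⟨hk, hz, hm, hl, h0⟩)))))

theorem exists_column : ∀ z : Fin 2 × Fin 4, z ≠ (0, 0) → z ≠ (1, 0) →
    ∃ k l m : Fin 4, [0, k, l, m].Nodup ∧ (z = (0, k) ∨ z = (1, k)) := by
  decide

set_option synthInstance.maxSize 1000 in
theorem exists_columns : ∀ z z' : Fin 2 × Fin 4, z ≠ (0, 0) → z' ≠ (0, 0) → z ≠ z' →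
    z = (1, 0) ∨ z' = (1, 0) ∨ ∃ k l m : Fin 4, [0, k, l, m].Nodup ∧
      (z = (0, k) ∨ z' = (0, k) ∨ (z = (1, k) ∧ z' = (1, l))) := by
  decide

theorem forall_of_nodup {R : Fin 2 × Fin 4 → Prop} (h1 : R (0, 1)) (h2 : R (0, 2)) (h3 : R (0, 3))
    {k l m : Fin 4} (h : [0, k, l, m].Nodup) : R (0, k) ∧ R (0, l) ∧ R (0, m) := by
  have : ∀ j : Fin 4, j ≠ 0 → R (0, j) := by
    intro j hj
    fin_cases j
    · exact absurd rfl hj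
    · exact h1
    · exact h2
    · exact h3
  simp only [List.nodup_cons, List.mem_cons, not_or] at h
  exact ⟨this _ (Ne.symm h.1.1), this _ (Ne.symm h.1.2.1), this _ (Ne.symm h.1.2.2.1)⟩

theorem hasSplitPattern_of_cross {P Q : Fin 2 × Fin 4 → Prop} (h0 : P (1, 0)) (h1 : Q (0, 1))
    (h2 : Q (0, 2)) (h3 : Q (0, 3)) {z : Fin 2 × Fin 4} (hz : P z) (hz0 : z ≠ (0, 0))
    (hz1 : z ≠ (1, 0)) : HasSplitPattern P Q ∨ HasSplitPattern Q P := by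
  obtain ⟨k, l, m, h, rfl | rfl⟩ := exists_column z hz0 hz1 <;>
    obtain ⟨hk, hl, hm⟩ := forall_of_nodup h1 h2 h3 h
  · have hlmk : [0, l, m, k].Nodup := by simp at h ⊢; tauto
    exact Or.inr (hasSplitPattern_of_columns hlmk (Or.inl ⟨hl, hm, hz, h0⟩))
  · exact Or.inl (hasSplitPattern_of_columns h (Or.inr (Or.inl ⟨h0, hz, hk, hl, hm⟩)))

theorem hasSplitPattern_of_all {P Q : Fin 2 × Fin 4 → Prop}
    (hP : ∀ u, ∃ z, P z ∧ z ≠ (0, 0) ∧ z ≠ u) (h0 : Q (1, 0)) (h1 : Q (0, 1)) (h2 : Q (0, 2))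
    (h3 : Q (0, 3)) : HasSplitPattern P Q ∨ HasSplitPattern Q P := by
  obtain ⟨z, hz, hz0, -⟩ := hP (0, 0)
  obtain ⟨z', hz', hz0', hzz'⟩ := hP z
  rcases exists_columns z z' hz0 hz0' hzz'.symm with rfl | rfl | ⟨k, l, m, h, hcases⟩
  · exact hasSplitPattern_of_cross hz h1 h2 h3 hz' hz0' hzz'
  · exact hasSplitPattern_of_cross hz' h1 h2 h3 hz hz0 hzz'.symm
  obtain ⟨hk, hl, hm⟩ := forall_of_nodup h1 h2 h3 h
  rcases hcases with rfl | rfl | ⟨rfl, rfl⟩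
  · exact hasSplitPattern_of_row h hz hl hm h0 hz' hz0' hzz'
  · exact hasSplitPattern_of_row h hz' hl hm h0 hz hz0 hzz'.symm
  · exact Or.inl (hasSplitPattern_of_columns h
      (Or.inr (Or.inr (Or.inr (Or.inr ⟨hz, hz', hk, hl, hm, h0⟩)))))

/-- The first two hypotheses say that each part sees two vertices besides (0, 0). The cases are the
ways to assign the four neighbours of (0, 0): two and two, one and three, or none and four.
`HasSplitPattern` is not symmetric, hence the disjunction. -/
theorem hasSplitPattern {P Q : Fin 2 × Fin 4 → Prop}
    (hP : ∀ u, ∃ z, P z ∧ z ≠ (0, 0) ∧ z ≠ u) (hQ : ∀ u, ∃ z, Q z ∧ z ≠ (0, 0) ∧ z ≠ u)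
    (hPQ : ∀ u, graphD17.Adj (0, 0) u → P u ∨ Q u) :
    HasSplitPattern P Q ∨ HasSplitPattern Q P := by
  have hrow : ∀ {P Q : Fin 2 × Fin 4 → Prop} {k l m : Fin 4},
      (∀ u, ∃ z, P z ∧ z ≠ (0, 0) ∧ z ≠ u) → [0, k, l, m].Nodup → P (0, k) → Q (0, l) →
      Q (0, m) → Q (1, 0) → HasSplitPattern P Q ∨ HasSplitPattern Q P :=
    fun {P Q k l m} hP h hk hl hm h0 => by
      obtain ⟨z, hz, hz0, hzk⟩ := hP (0, k)
      exact hasSplitPattern_of_row h hk hl hm h0 hz hz0 hzk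
  have hcross : ∀ {P Q : Fin 2 × Fin 4 → Prop}, (∀ u, ∃ z, P z ∧ z ≠ (0, 0) ∧ z ≠ u) →
      P (1, 0) → Q (0, 1) → Q (0, 2) → Q (0, 3) → HasSplitPattern P Q ∨ HasSplitPattern Q P :=
    fun {P Q} hP h0 h1 h2 h3 => by
      obtain ⟨z, hz, hz0, hzk⟩ := hP (1, 0)
      exact hasSplitPattern_of_cross h0 h1 h2 h3 hz hz0 hzk
  have h123 : [(0 : Fin 4), 1, 2, 3].Nodup := by decide
  have h132 : [(0 : Fin 4), 1, 3, 2].Nodup := by decide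
  have h213 : [(0 : Fin 4), 2, 1, 3].Nodup := by decide
  have h231 : [(0 : Fin 4), 2, 3, 1].Nodup := by decide
  have h312 : [(0 : Fin 4), 3, 1, 2].Nodup := by decide
  rcases hPQ (1, 0) (by decide) with h0 | h0 <;> rcases hPQ (0, 1) (by decide) with h1 | h1 <;>
    rcases hPQ (0, 2) (by decide) with h2 | h2 <;> rcases hPQ (0, 3) (by decide) with h3 | h3
  · exact (hasSplitPattern_of_all hQ h0 h1 h2 h3).symm
  · exact (hrow hQ h312 h3 h1 h2 h0).symm
  · exact (hrow hQ h213 h2 h1 h3 h0).symm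
  · exact Or.inr (hasSplitPattern_of_columns h231 (Or.inl ⟨h2, h3, h1, h0⟩))
  · exact (hrow hQ h123 h1 h2 h3 h0).symm
  · exact Or.inr (hasSplitPattern_of_columns h132 (Or.inl ⟨h1, h3, h2, h0⟩))
  · exact Or.inr (hasSplitPattern_of_columns h123 (Or.inl ⟨h1, h2, h3, h0⟩))
  · exact hcross hP h0 h1 h2 h3
  · exact (hcross hQ h0 h1 h2 h3).symm
  · exact Or.inl (hasSplitPattern_of_columns h123 (Or.inl ⟨h1, h2, h3, h0⟩))
  · exact Or.inl (hasSplitPattern_of_columns h132 (Or.inl ⟨h1, h3, h2, h0⟩))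
  · exact hrow hP h123 h1 h2 h3 h0
  · exact Or.inl (hasSplitPattern_of_columns h231 (Or.inl ⟨h2, h3, h1, h0⟩))
  · exact hrow hP h213 h2 h1 h3 h0
  · exact hrow hP h312 h3 h1 h2 h0
  · exact hasSplitPattern_of_all hP h0 h1 h2 h3

/-! ### Symmetries of `D₁₇` and the conclusion -/

theorem graphD17_adj_prodCongr (q : Equiv.Perm (Fin 2)) (p : Equiv.Perm (Fin 4))
    (a b : Fin 2 × Fin 4) :
    graphD17.Adj (Equiv.prodCongr q p a) (Equiv.prodCongr q p b) ↔ graphD17.Adj a b := by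
  simp [graphD17]

theorem four_le_ncard_neighborSet_graphD17 (w : Fin 2 × Fin 4) :
    4 ≤ (graphD17.neighborSet w).ncard := by
  rw [← Nat.card_coe_set_eq, Nat.card_eq_fintype_card]
  revert w
  decide

open SimpleGraph in
theorem isMinor_of_hasSplitPattern {V : Type*} {G : SimpleGraph V} (f : V → Fin 2 × Fin 4)
    (hf : ∀ w, G.ConnOn {v | f v = w})
    (hadj : ∀ u w, graphD17.Adj u w → ∃ x y, f x = u ∧ f y = w ∧ G.Adj x y)
    (σ : Fin 2 × Fin 4 ≃ Fin 2 × Fin 4) (hσ : ∀ a b, graphD17.Adj (σ a) (σ b) ↔ graphD17.Adj a b)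
    {X Y : Set V} (hXY : X ∪ Y = {v | f v = σ (0, 0)}) (hd : Disjoint X Y) (hX : G.ConnOn X)
    (hY : G.ConnOn Y) {P Q : Fin 2 × Fin 4 → Prop}
    (hP : ∀ s, P s → ∃ x ∈ X, ∃ y, f y = σ s ∧ s ≠ (0, 0) ∧ G.Adj x y)
    (hQ : ∀ s, Q s → ∃ x ∈ Y, ∃ y, f y = σ s ∧ s ≠ (0, 0) ∧ G.Adj x y)
    (h : HasSplitPattern P Q) :
    (completeBipartiteGraph (Fin 3) (Fin 4)).IsMinor G ∨ graphE20.IsMinor G := by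
  obtain ⟨p, hp0, ST, hST, hS, hT⟩ := h
  -- Relabelling the fibres by τ puts the split vertex at (0, 0) and turns the permuted pattern into
  -- a listed one.
  let τ := (Equiv.prodCongr (Equiv.refl (Fin 2)) p).trans σ
  have hτ : ∀ s : Fin 2 × Fin 4, τ s = σ (s.1, p s.2) := fun s => rfl
  have hτ0 : τ (0, 0) = σ (0, 0) := by rw [hτ, hp0]
  have hτadj : ∀ a b, graphD17.Adj (τ a) (τ b) ↔ graphD17.Adj a b := fun a b =>
    (hσ _ _).trans (graphD17_adj_prodCongr _ _ _ _)
  have hfib : ∀ w, {v | τ.symm (f v) = w} = {v | f v = τ w} := fun w => by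
    ext v
    exact τ.symm_apply_eq
  have hne : ∀ s : Fin 2 × Fin 4, (s.1, p s.2) ≠ (0, 0) → s ≠ (0, 0) := by
    rintro s h rfl
    exact h (by simp [hp0])
  have hminor : (graphD17.splitVertex (0, 0) ST.1 ST.2).IsMinor G := by
    refine splitVertex_isMinor (X := X) (Y := Y) (fun v => τ.symm (f v))
      (fun w => hfib w ▸ hf _) (fun u w huw => ?_) (by rw [hfib, hτ0, hXY]) hd hX hY
      (fun s hs => ?_) (fun s hs => ?_)
    · obtain ⟨x, y, hx, hy, hxy⟩ := hadj _ _ ((hτadj u w).2 huw)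
      exact ⟨x, y, τ.symm_apply_eq.2 hx, τ.symm_apply_eq.2 hy, hxy⟩
    · obtain ⟨x, hx, y, hy, hs0, hxy⟩ := hP _ (hS s hs)
      exact ⟨x, hx, y, τ.symm_apply_eq.2 hy, hne s hs0, hxy⟩
    · obtain ⟨x, hx, y, hy, hs0, hxy⟩ := hQ _ (hT s hs)
      exact ⟨x, hx, y, τ.symm_apply_eq.2 hy, hne s hs0, hxy⟩
  exact (isMinor_splitVertex_of_mem_splitPatterns ST hST).imp (fun h => h.trans hminor)
    fun h => h.trans hminor

open SimpleGraph in
theorem mainTheorem7 {V : Type*} [Finite V] (G : SimpleGraph V)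
    (hconn : G.IsKConnected 3)
    (hminor : graphD17.IsMinor G)
    (hcard : Nat.card (Fin 2 × Fin 4) < Nat.card V) :
    (completeBipartiteGraph (Fin 3) (Fin 4)).IsMinor G ∨ graphE20.IsMinor G := by
  have huniv : G.ConnOn Set.univ := by
    have := connected_induce_iff_connOn.1 (hconn.2 ∅ (by simp))
    rwa [Set.compl_empty] at this
  obtain ⟨f, hf, hadj⟩ := hminor.exists_covering huniv
  obtain ⟨w, X, hXw, hX, hY, hX2, hY2⟩ :=
    exists_splittable_fibre hconn four_le_ncard_neighborSet_graphD17 hcard f hf hadj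
  let σ := Equiv.prodCongr (Equiv.swap 0 w.1) (Equiv.swap 0 w.2)
  have hσ0 : σ (0, 0) = w := by simp [σ]
  have hσ : ∀ a b, graphD17.Adj (σ a) (σ b) ↔ graphD17.Adj a b := graphD17_adj_prodCongr _ _
  have hXY : X ∪ {v | f v = w} \ X = {v | f v = σ (0, 0)} := by
    rw [hσ0, Set.union_sdiff_cancel hXw]
  have hd : Disjoint X ({v | f v = w} \ X) := Set.disjoint_sdiff_right
  have hsees : ∀ {Z : Set V}, Z ⊆ {v | f v = w} →
      2 ≤ (⋃ x ∈ Z, {u | u ≠ f x ∧ ∃ y, f y = u ∧ G.Adj x y}).ncard →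
      ∀ u, ∃ z, (∃ x ∈ Z, ∃ y, f y = σ z ∧ z ≠ (0, 0) ∧ G.Adj x y) ∧ z ≠ (0, 0) ∧ z ≠ u := by
    intro Z hZ h2 u
    obtain ⟨z, hz, hzu⟩ := Set.exists_ne_of_one_lt_ncard h2 (σ u)
    obtain ⟨x, hx, hzx, y, hy, hxy⟩ := Set.mem_iUnion₂.1 hz
    have hz0 : σ.symm z ≠ (0, 0) := fun h => hzx (by
      rw [σ.symm_apply_eq.1 h, hσ0]
      exact (hZ hx).symm)
    exact ⟨σ.symm z, ⟨x, hx, y, by simpa using hy, hz0, hxy⟩, hz0,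
      fun h => hzu (σ.symm_apply_eq.1 h)⟩
  rcases hasSplitPattern (hsees hXw hX2) (hsees Set.sdiff_subset hY2) (fun u hu => by
    obtain ⟨x, y, hx, hy, hxy⟩ := hadj _ _ ((hσ (0, 0) u).2 hu)
    have hu0 : u ≠ (0, 0) := (graphD17.ne_of_adj hu).symm
    by_cases hxX : x ∈ X
    · exact Or.inl ⟨x, hxX, y, hy, hu0, hxy⟩
    · exact Or.inr ⟨x, ⟨hx.trans hσ0, hxX⟩, y, hy, hu0, hxy⟩) with h | h
  · exact isMinor_of_hasSplitPattern f hf hadj σ hσ hXY hd hX hY (fun _ h => h) (fun _ h => h) h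
  · exact isMinor_of_hasSplitPattern f hf hadj σ hσ (Set.union_comm _ _ ▸ hXY) hd.symm hY hX
      (fun _ h => h) (fun _ h => h) h
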